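/- **Setting.** Let $\mathcal G$ be a weighted digraph on agents $1,\dots,n$ with weights $a_{ij}\ge 0$, $a_{ii}=0$, where $a_{ij}>0$ iff there is a link from $j$ to $i$, and let $L=\mathrm{diag}\big(\sum_j a_{1j},\dots,\sum_j a_{nj}\big)-(a_{ij})$ be its Laplacian. Suppose $\mathcal G$ has a directed spanning tree (some agent has a directed path to every other agent) and the agents are numbered such that $L$ is block upper triangular with diagonal blocks $L^{1,1},\dots,L^{M,M}$ that correspond to the strongly connected components of $\mathcal G$. Let $\tilde L^{M,M}$ be $L^{M,M}$ with its diagonal entries replaced so that all row sums are zero, let $\xi^M$ be the positive left eigenvector of $\tilde L^{M,M}$ for the eigenvalue $0$ with entries of sum $1$, and let $\nu(t)=\sum_{i}\xi^M_i x^M_i(t)\in\mathbb R^p$ be the weighted average of the states of the agents in the last (root) component. Let $h>0$ and $g(s)=(g_1(s_1),\dots,g_p(s_p))$ for $s\in\mathbb R^p$, where each $g_l:\mathbb R\to\mathbb R$ is (1) continuous, (2) nondecreasing, and strictly increasing on $[-h,h]$, (3) zero exactly at $0$, (4) Lipschitz on every compact set, and (5) such that for some $\varrho>0$, $|g_l(x)-g_l(y)|\ge\varrho|x-y|$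 for all $x,y\in[-h,h]$. Given $\alpha_i,\beta_i>0$, consider the states $x_i(t)\in\mathbb R^p$ with $$\dot x_i(t)=-\sum_{j=1}^n L_{ij}\,g(\hat x_j(t)),\qquad \hat x_j(t)=x_j\big(t^j_{k_j(t)}\big),\quad k_j(t)=\max\{k: t^j_k\le t\},$$ where the triggering times are $t^i_1=0$ and $$t^i_{k+1}=\max\big\{r\ge t^i_k:\ \|g(x_i(t^i_k))-g(x_i(t))\|^2\le\alpha_i e^{-\beta_i t}\ \ \forall t\in[t^i_k,r]\big\};$$ if there is no maximum because the bound holds for all $t\ge t_k^i$, agent $i$ does not trigger again. (In the maximum, $x_i$ past $t^i_{k+1}$ stands for a continuation of the motion of agent $i$ in which it has not been resampled.) Suppose that $x(0)\ne \mathbf 1_n\otimes\nu(0)$, i.e. $x_i(0)\neq\nu(0)$ for some $i$. **Theorem.** (i) There is no Zeno behaviour: for every $0<T\le\infty$ and every trajectory of the closed-loop system on $[0,T)$, each agent has only finitely many triggering times in each bounded part of $[0,T)$ (so on all of $[0,T)$ if $T<\infty$). (ii) If $|\nu_l(0)|<h$ for all $l=1,\dots,p$, then every trajectory on $[0,\infty)$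 reaches consensus with consensus value $\nu(0)$: $\lim_{t\to\infty}x_i(t)=\nu(0)$ for all $i$. -/

import Mathlib

open Filter Topology Set

noncomputable section

namespace EventTriggered

/-- A weighted directed graph on the agents `0, …, n - 1`. The entry `weight i j` is the weight of
the link from agent `j` to agent `i`; the link is present iff the weight is positive. -/
structure WeightedDigraph (n : ℕ) where
  weight : Matrix (Fin n) (Fin n) ℝ
  weight_nonneg : ∀ i j, 0 ≤ weight i j
  weight_self : ∀ i, weight i i = 0

namespace WeightedDigraph

variable {n : ℕ} (G : WeightedDigraph n)

/-- There is a link from agent `i` to agent `j`. -/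
def Link (i j : Fin n) : Prop := 0 < G.weight j i

/-- There is a directed path (possibly of length zero) from agent `i` to agent `j`. -/
def Reaches (i j : Fin n) : Prop := Relation.ReflTransGen G.Link i j

/-- Some agent has a directed path to every agent. -/
def HasSpanningTree : Prop := ∃ r, ∀ i, G.Reaches r i

/-- The Laplacian: in-degree matrix minus weight matrix. -/
def laplacian : Matrix (Fin n) (Fin n) ℝ :=
  Matrix.diagonal (fun i => ∑ j, G.weight i j) - G.weight

/-- The Laplacian is block upper triangular, the blocks being the strongly connected components:
`c i` is the number of the component of agent `i`, and agents are numbered component by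
component. -/
structure IsPerronFrobeniusForm {M : ℕ} (c : Fin n → Fin (M + 1)) : Prop where
  monotone : Monotone c
  surjective : Function.Surjective c
  component_iff : ∀ i j, c i = c j ↔ G.Reaches i j ∧ G.Reaches j i
  upper : ∀ i j, c j < c i → G.laplacian i j = 0

/-- The diagonal block of the Laplacian that belongs to component `m`. -/
def block {M : ℕ} (c : Fin n → Fin (M + 1)) (m : Fin (M + 1)) :
    Matrix {i // c i = m} {i // c i = m} ℝ :=
  G.laplacian.submatrix (fun i => i.1) (fun i => i.1)

/-- The diagonal block with its diagonal changed so that all row sums vanish. -/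
def blockTilde {M : ℕ} (c : Fin n → Fin (M + 1)) (m : Fin (M + 1)) :
    Matrix {i // c i = m} {i // c i = m} ℝ :=
  fun i j => if i = j then -∑ r ∈ Finset.univ.erase i, G.block c m i r else G.block c m i j

/-- `ξ` is the positive left eigenvector of the modified diagonal block of component `m` for the
eigenvalue zero, normalized to have sum one. -/
structure IsPerronVector {M : ℕ} (c : Fin n → Fin (M + 1)) (m : Fin (M + 1))
    (ξ : {i // c i = m} → ℝ) : Prop where
  pos : ∀ i, 0 < ξ i
  sum_eq_one : ∑ i, ξ i = 1
  left_null : Matrix.vecMul ξ (G.blockTilde c m) = 0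

end WeightedDigraph

/-- The assumptions on a scalar output function `f`, with the constant `h`. -/
structure OutputAssumption (f : ℝ → ℝ) (h : ℝ) : Prop where
  continuous : Continuous f
  monotone : Monotone f
  h_pos : 0 < h
  strictMonoOn : StrictMonoOn f (Icc (-h) h)
  eq_zero_iff : ∀ x, f x = 0 ↔ x = 0
  lipschitz : ∀ S : Set ℝ, IsCompact S → ∃ K > 0, ∀ x ∈ S, ∀ y ∈ S, |f x - f y| ≤ K * |x - y|
  lower : ∃ ϱ > 0, ∀ x ∈ Icc (-h) h, ∀ y ∈ Icc (-h) h, ϱ * |x - y| ≤ |f x - f y|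

/-- The componentwise output map on `ℝ^p`. -/
def output {p : ℕ} (g : Fin p → ℝ → ℝ) (s : EuclideanSpace ℝ (Fin p)) :
    EuclideanSpace ℝ (Fin p) :=
  WithLp.toLp 2 (fun l => g l (s l))

/-- At time `s`, the motion `z`, last sampled at time `a`, satisfies the error bound
`‖g(z(a)) - g(z(s))‖² ≤ α e^{-β s}`. -/
def ErrorBound {p : ℕ} (g : Fin p → ℝ → ℝ) (α β : ℝ) (z : ℝ → EuclideanSpace ℝ (Fin p))
    (a s : ℝ) : Prop :=
  ‖output g (z a) - output g (z s)‖ ^ 2 ≤ α * Real.exp (-β * s)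

/-- The number of the last triggering time that is `≤ s`; in a trajectory these numbers are bounded
and the supremum is a maximum. -/
def lastIndex (τ : ℕ → EReal) (s : ℝ) : ℕ := sSup {k | τ k ≤ (s : EReal)}

/-- The state of an agent at its last triggering time `≤ s`. -/
def sampled {p : ℕ} (x : ℝ → EuclideanSpace ℝ (Fin p)) (τ : ℕ → EReal) (s : ℝ) :
    EuclideanSpace ℝ (Fin p) :=
  x (τ (lastIndex τ s)).toReal

/-- The event-triggered consensus protocol: the input of agent `i` at time `s`. -/
def input {n p : ℕ} (G : WeightedDigraph n) (g : Fin p → ℝ → ℝ)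
    (x : Fin n → ℝ → EuclideanSpace ℝ (Fin p)) (τ : Fin n → ℕ → EReal) (i : Fin n) (s : ℝ) :
    EuclideanSpace ℝ (Fin p) :=
  -∑ j, G.laplacian i j • output g (sampled (x j) (τ j) s)

/-- `x` and `τ` are the states and the triggering times of the closed-loop system on `[0, T)`, where
`0 < T ≤ ∞`.

The triggering times are numbered from `0`. If agent `i` has only finitely many of them before `T`,
the remaining terms of `τ i` are `≥ T` (hence `⊤` when `T = ⊤`) and are no events of the trajectory.

In `trigger`, the next triggering time `b` is the largest `r` such that the error bound holds on
`[a, r]`. The error in this maximum is the one of an agent that is not resampled at `b`, whereas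
from `b` on the state `x i` moves under the updated input; so the maximum is taken along a
continuous motion `z` that is `x i` up to time `b`. Nothing else is asked of `z`, so that the
trajectories of the law are included however a continuation past `b` is chosen.

Since the input is right-continuous and piecewise constant, the differential equation is expressed
by continuity and right derivatives. Existence of a last triggering time is required at each time
`s < T` only, which leaves open whether triggering times accumulate at `T`. -/
structure IsTrajectory {n p : ℕ} (G : WeightedDigraph n) (g : Fin p → ℝ → ℝ) (α β : Fin n → ℝ)
    (T : EReal) (x : Fin n → ℝ → EuclideanSpace ℝ (Fin p)) (τ : Fin n → ℕ → EReal) : Prop where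
  horizon_pos : 0 < T
  first : ∀ i, τ i 0 = 0
  monotone : ∀ i, Monotone (τ i)
  trigger : ∀ i k (a : ℝ), τ i k = (a : EReal) → (a : EReal) < T →
    (∃ b : ℝ, τ i (k + 1) = (b : EReal) ∧ (b : EReal) < T ∧
      ∃ z : ℝ → EuclideanSpace ℝ (Fin p), Continuous z ∧ EqOn z (x i) (Icc a b) ∧
        IsGreatest {r | a ≤ r ∧ ∀ s ∈ Icc a r, ErrorBound g (α i) (β i) z a s} b) ∨
    (T ≤ τ i (k + 1) ∧
      ∀ s : ℝ, a ≤ s → (s : EReal) < T → ErrorBound g (α i) (β i) (x i) a s)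
  last : ∀ i (s : ℝ), 0 ≤ s → (s : EReal) < T → BddAbove {k | τ i k ≤ (s : EReal)}
  continuousOn : ∀ i, ContinuousOn (x i) {s : ℝ | 0 ≤ s ∧ (s : EReal) < T}
  deriv_right : ∀ i (s : ℝ), 0 ≤ s → (s : EReal) < T →
    HasDerivWithinAt (x i) (input G g x τ i s) (Ici s) s

/-- Every agent triggers only finitely often in every bounded part of `[0, T)`; if `T < ∞`, this
bounds the number of events on all of `[0, T)`. -/
def NoZeno {n : ℕ} (T : EReal) (τ : Fin n → ℕ → EReal) : Prop :=
  ∀ i (b : ℝ), {k | τ i k ≤ (b : EReal) ∧ τ i k < T}.Finite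

/-- The weighted average `ν(s)` of the states in component `m`. -/
def componentAverage {n p M : ℕ} (c : Fin n → Fin (M + 1)) (m : Fin (M + 1))
    (ξ : {i // c i = m} → ℝ) (x : Fin n → ℝ → EuclideanSpace ℝ (Fin p)) (s : ℝ) :
    EuclideanSpace ℝ (Fin p) :=
  ∑ r, ξ r • x r.1 s

end EventTriggered

end

/-!
In each coordinate the closed loop reads `y' = -L (f(y) + e)`, where the sampling error `e` is
exponentially small, hence integrable. By the maximum principle for `L`, the states then stay
bounded, so that the outputs are uniformly continuous in time; as an output has to change by a
fixed amount between two events of an agent before a given time, the events are separated.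

For the consensus let `θ` be the conserved average `∑ i, ξ i * y i`. The function
`∑ i, ζ i * ∫ s in θ..y i, (f s - f θ)` is a Lyapunov function up to integrable errors if
`u ↦ ∑ i, ζ i * u i * (L u) i` is coercive on the deviations `u = f(y) - f(θ)`, which change sign
on the root component as `θ` is an average over it. Such weights `ζ` arise by adding a multiple
of `ξ` to a solution of `ω (L + e_r e_rᵀ) = 1` for a root `r`: the form of `ω` controls all of `u`
up to `(u r)²`, and `(u r)²` is controlled by the form of `ξ` because of the sign change. Hence the
deviations get small at some late time, and by the maximum principle they stay small.
-/

open scoped Matrix Matrix.Norms.Operator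

namespace EventTriggered

section Comparison

theorem eventually_le_of_deriv_right_lt {u v : ℝ → ℝ} {u' v' t : ℝ}
    (hu : HasDerivWithinAt u u' (Ici t) t) (hv : HasDerivWithinAt v v' (Ici t) t)
    (hle : u t ≤ v t) (hlt : u t = v t → u' < v') : ∀ᶠ s in 𝓝[>] t, u s ≤ v s := by
  have hsub : HasDerivWithinAt (fun s => u s - v s) (u' - v') (Ici t) t := hu.sub hv
  rcases hle.lt_or_eq with hlt' | heq
  · have hcont := hsub.continuousWithinAt.tendsto.mono_left
      (nhdsWithin_mono t Ioi_subset_Ici_self)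
    filter_upwards [hcont.eventually_lt_const (sub_neg.mpr hlt')] with s hs
    exact (sub_neg.mp hs).le
  · have hslope := hsub.limsup_slope_le (r := 0) (sub_neg.mpr (hlt heq))
    rw [Ici_sdiff_left] at hslope
    filter_upwards [hslope, self_mem_nhdsWithin] with s hs hts
    rw [slope_def_field, div_lt_iff₀ (sub_pos.mpr hts)] at hs
    linarith

variable {ι : Type*} [Finite ι] {y y' : ℝ → ι → ℝ} {B B' : ℝ → ℝ} {a b : ℝ}

theorem image_le_of_deriv_right_lt_at_max (hy : ContinuousOn y (Icc a b))
    (hy' : ∀ t ∈ Ico a b, HasDerivWithinAt y (y' t) (Ici t) t)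
    (ha : ∀ i, y a i ≤ B a) (hB : ContinuousOn B (Icc a b))
    (hB' : ∀ t ∈ Ico a b, HasDerivWithinAt B (B' t) (Ici t) t)
    (bound : ∀ t ∈ Ico a b, ∀ i, (∀ j, y t j ≤ y t i) → y' t i < B' t)
    {t : ℝ} (ht : t ∈ Icc a b) (i : ι) : y t i ≤ B t := by
  have hclosed : IsClosed ({t | ∀ i, y t i ≤ B t} ∩ Icc a b) := by
    rw [inter_comm]
    exact isClosed_Icc.isClosed_le hy (continuousOn_pi.mpr fun _ => hB)
  refine hclosed.Icc_subset_of_forall_exists_gt ha ?_ ht i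
  rintro s ⟨hs, hsI⟩ z hz
  have hright : ∀ᶠ r in 𝓝[>] s, ∀ i, y r i ≤ B r := by
    refine eventually_all.mpr fun i => eventually_le_of_deriv_right_lt
      (hasDerivWithinAt_pi.mp (hy' s hsI) i) (hB' s hsI) (hs i) fun heq => ?_
    exact bound s hsI i fun j => heq ▸ hs j
  exact (hright.and (Ioc_mem_nhdsGT hz)).exists

theorem image_le_of_deriv_right_le_at_max (hy : ContinuousOn y (Icc a b))
    (hy' : ∀ t ∈ Ico a b, HasDerivWithinAt y (y' t) (Ici t) t)
    (ha : ∀ i, y a i ≤ B a) (hB : ContinuousOn B (Icc a b))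
    (hB' : ∀ t ∈ Ico a b, HasDerivWithinAt B (B' t) (Ici t) t)
    (bound : ∀ t ∈ Ico a b, ∀ i, (∀ j, y t j ≤ y t i) → y' t i ≤ B' t)
    {t : ℝ} (ht : t ∈ Icc a b) (i : ι) : y t i ≤ B t := by
  have hslack : ∀ δ > 0, y t i ≤ B t + δ * (t - a) := fun δ hδ => by
    have hδ' : ∀ s, HasDerivAt (fun s => δ * (s - a)) δ s := fun s => by
      simpa using ((hasDerivAt_id s).sub_const a).const_mul δ
    refine image_le_of_deriv_right_lt_at_max (B := fun s => B s + δ * (s - a))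
      (B' := fun s => B' s + δ) hy hy' (by simpa using ha) (hB.add (by fun_prop))
      (fun s hs => (hB' s hs).add (hδ' s).hasDerivWithinAt) (fun s hs i hi => ?_) ht i
    linarith [bound s hs i hi]
  have hlim : Tendsto (fun δ => B t + δ * (t - a)) (𝓝[>] 0) (𝓝 (B t)) := by
    have hcont : Continuous fun δ => B t + δ * (t - a) := by fun_prop
    simpa using (hcont.tendsto 0).mono_left nhdsWithin_le_nhds
  exact ge_of_tendsto hlim (eventually_mem_nhdsWithin.mono hslack)

end Comparison

namespace WeightedDigraph

variable {n : ℕ} {G : WeightedDigraph n}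

section Laplacian

theorem laplacian_mulVec (u : Fin n → ℝ) (i : Fin n) :
    (G.laplacian *ᵥ u) i = ∑ j, G.weight i j * (u i - u j) := by
  simp [laplacian, Matrix.mulVec, dotProduct, Matrix.diagonal_apply, sub_mul, mul_sub,
    Finset.sum_mul]

theorem sum_laplacian (i : Fin n) : ∑ j, G.laplacian i j = 0 := by
  simpa [Matrix.mulVec, dotProduct] using G.laplacian_mulVec (fun _ => 1) i

theorem laplacian_of_ne {i j : Fin n} (h : i ≠ j) : G.laplacian i j = -G.weight i j := by
  simp [laplacian, h]

theorem laplacian_mulVec_add_const (u : Fin n → ℝ) (a : ℝ) :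
    G.laplacian *ᵥ (fun i => u i + a) = G.laplacian *ᵥ u := by
  ext i
  simp only [laplacian_mulVec, add_sub_add_right_eq_sub]

theorem laplacian_mulVec_nonneg_of_forall_le {u : Fin n → ℝ} {i : Fin n} (h : ∀ j, u j ≤ u i) :
    0 ≤ (G.laplacian *ᵥ u) i := by
  rw [laplacian_mulVec]
  exact Finset.sum_nonneg fun j _ => mul_nonneg (G.weight_nonneg i j) (sub_nonneg.mpr (h j))

theorem laplacian_mulVec_nonpos_of_forall_le {u : Fin n → ℝ} {i : Fin n} (h : ∀ j, u i ≤ u j) :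
    (G.laplacian *ᵥ u) i ≤ 0 := by
  rw [laplacian_mulVec]
  exact Finset.sum_nonpos fun j _ =>
    mul_nonpos_of_nonneg_of_nonpos (G.weight_nonneg i j) (sub_nonpos.mpr (h j))

theorem eq_of_link_of_forall_le {u : Fin n → ℝ} {i j : Fin n} (hij : G.Link j i)
    (hmin : ∀ k, u i ≤ u k) (hu : 0 ≤ (G.laplacian *ᵥ u) i) : u j = u i := by
  have hsum := (laplacian_mulVec_nonpos_of_forall_le hmin).antisymm hu
  rw [laplacian_mulVec, Finset.sum_eq_zero_iff_of_nonpos fun k _ =>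
    mul_nonpos_of_nonneg_of_nonpos (G.weight_nonneg i k) (sub_nonpos.mpr (hmin k))] at hsum
  have hj := (mul_eq_zero.mp (hsum j (Finset.mem_univ j))).resolve_left (ne_of_gt hij)
  exact (sub_eq_zero.mp hj).symm

/-- The carré du champ `2 u (L u) - L (u²)` of the Laplacian: the squared differences between an
agent and its in-neighbours, weighted by the links. -/
def energy (G : WeightedDigraph n) (u : Fin n → ℝ) (i : Fin n) : ℝ :=
  ∑ j, G.weight i j * (u i - u j) ^ 2

theorem energy_nonneg (u : Fin n → ℝ) : 0 ≤ G.energy u := fun i =>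
  Finset.sum_nonneg fun j _ => mul_nonneg (G.weight_nonneg i j) (sq_nonneg _)

theorem two_mul_laplacian_mulVec (u : Fin n → ℝ) :
    (2 : ℝ) • (u * G.laplacian *ᵥ u) = G.laplacian *ᵥ (u ^ 2) + G.energy u := by
  ext i
  simp only [Pi.smul_apply, Pi.mul_apply, Pi.add_apply, laplacian_mulVec, energy, smul_eq_mul,
    Finset.mul_sum, ← Finset.sum_add_distrib, Pi.pow_apply]
  exact Finset.sum_congr rfl fun j _ => by ring

end Laplacian

section Pinning

/-- The Laplacian pinned at the agent `r`, which gets an additional link of weight one from an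
exosystem at rest at zero. -/
def pinnedLaplacian (G : WeightedDigraph n) (r : Fin n) : Matrix (Fin n) (Fin n) ℝ :=
  G.laplacian + Matrix.diagonal (Pi.single r 1)

theorem pinnedLaplacian_mulVec (r : Fin n) (u : Fin n → ℝ) :
    G.pinnedLaplacian r *ᵥ u = G.laplacian *ᵥ u + Pi.single r (u r) := by
  ext i
  rcases eq_or_ne i r with rfl | hi
  · simp [pinnedLaplacian, Matrix.add_mulVec, Matrix.mulVec_diagonal]
  · simp [pinnedLaplacian, Matrix.add_mulVec, Matrix.mulVec_diagonal, hi]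

variable {r : Fin n} (hr : ∀ i, G.Reaches r i)

include hr

theorem nonneg_of_pinnedLaplacian_mulVec_nonneg {u : Fin n → ℝ}
    (hu : 0 ≤ G.pinnedLaplacian r *ᵥ u) : 0 ≤ u := by
  rw [pinnedLaplacian_mulVec] at hu
  have : Nonempty (Fin n) := ⟨r⟩
  obtain ⟨k, hk⟩ := Finite.exists_min u
  suffices hk0 : 0 ≤ u k from fun i => hk0.trans (hk i)
  by_contra! hneg
  have hpred : ∀ i, G.Reaches i k → u i = u k := fun i hi => by
    induction hi using Relation.ReflTransGen.head_induction_on with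
    | refl => rfl
    | @head j i hji _ hi =>
      have hpin : Pi.single (M := fun _ => ℝ) r (u r) i ≤ 0 := by
        rcases eq_or_ne i r with rfl | hir
        · simpa [hi] using hneg.le
        · simp [hir]
      have hi0 := hu i
      simp only [Pi.zero_apply, Pi.add_apply] at hi0
      exact (eq_of_link_of_forall_le hji (fun m => hi ▸ hk m) (by linarith)).trans hi
  have hrk := hpred r (hr k)
  have hr0 := hu r
  simp only [Pi.zero_apply, Pi.add_apply, Pi.single_eq_same] at hr0
  linarith [G.laplacian_mulVec_nonpos_of_forall_le fun m => hrk ▸ hk m]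

theorem isUnit_pinnedLaplacian : IsUnit (G.pinnedLaplacian r) := by
  refine Matrix.mulVec_injective_iff_isUnit.mp fun u v (huv : _ *ᵥ u = _ *ᵥ v) => ?_
  have hvu : 0 ≤ u - v := nonneg_of_pinnedLaplacian_mulVec_nonneg hr (by
    rw [Matrix.mulVec_sub, huv, sub_self])
  have huv : 0 ≤ v - u := nonneg_of_pinnedLaplacian_mulVec_nonneg hr (by
    rw [Matrix.mulVec_sub, huv, sub_self])
  exact (sub_nonneg.mp huv).antisymm (sub_nonneg.mp hvu)

theorem pinnedLaplacian_inv_nonneg (i j : Fin n) : 0 ≤ (G.pinnedLaplacian r)⁻¹ i j := by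
  have hdet := (Matrix.isUnit_iff_isUnit_det _).mp (isUnit_pinnedLaplacian hr)
  have hcol : G.pinnedLaplacian r *ᵥ (G.pinnedLaplacian r)⁻¹ *ᵥ Pi.single j 1 =
      Pi.single j 1 := by
    rw [Matrix.mulVec_mulVec, Matrix.mul_nonsing_inv _ hdet, Matrix.one_mulVec]
  have hnonneg := nonneg_of_pinnedLaplacian_mulVec_nonneg hr
    (hcol ▸ Pi.single_nonneg.mpr zero_le_one)
  simpa using hnonneg i

theorem exists_nonneg_vecMul_pinnedLaplacian :
    ∃ ω : Fin n → ℝ, 0 ≤ ω ∧ ω ᵥ* G.pinnedLaplacian r = 1 := by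
  refine ⟨1 ᵥ* (G.pinnedLaplacian r)⁻¹, fun j => ?_, ?_⟩
  · simp only [Pi.zero_apply, Matrix.vecMul, dotProduct, Pi.one_apply, one_mul]
    exact Finset.sum_nonneg fun i _ => pinnedLaplacian_inv_nonneg hr i j
  · rw [Matrix.vecMul_vecMul, Matrix.nonsing_inv_mul _
      ((Matrix.isUnit_iff_isUnit_det _).mp (isUnit_pinnedLaplacian hr)), Matrix.vecMul_one]

end Pinning

/-- A stationary distribution of the Markov chain that moves from each agent to an in-neighbour at
the rates given by the weights, whose generator is the negative Laplacian. -/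
structure IsStationary (G : WeightedDigraph n) (ξ : Fin n → ℝ) : Prop where
  nonneg : 0 ≤ ξ
  sum_eq_one : ∑ i, ξ i = 1
  vecMul_laplacian : ξ ᵥ* G.laplacian = 0

namespace IsStationary

variable {ξ : Fin n → ℝ}

theorem dotProduct_laplacian_mulVec (hξ : G.IsStationary ξ) (u : Fin n → ℝ) :
    ξ ⬝ᵥ G.laplacian *ᵥ u = 0 := by
  rw [Matrix.dotProduct_mulVec, hξ.vecMul_laplacian, zero_dotProduct]

theorem two_mul_dotProduct_mul_laplacian_mulVec (hξ : G.IsStationary ξ) (u : Fin n → ℝ) :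
    2 * ξ ⬝ᵥ (u * G.laplacian *ᵥ u) = ξ ⬝ᵥ G.energy u := by
  rw [← smul_eq_mul, ← dotProduct_smul, two_mul_laplacian_mulVec, dotProduct_add,
    hξ.dotProduct_laplacian_mulVec, zero_add]

theorem dotProduct_energy_nonneg (hξ : G.IsStationary ξ) (u : Fin n → ℝ) :
    0 ≤ ξ ⬝ᵥ G.energy u :=
  dotProduct_nonneg_of_nonneg hξ.nonneg (energy_nonneg u)

theorem exists_pos (hξ : G.IsStationary ξ) : ∃ i, 0 < ξ i := by
  obtain ⟨i, -, hi⟩ := Finset.exists_ne_zero_of_sum_ne_zero (hξ.sum_eq_one ▸ one_ne_zero)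
  exact ⟨i, (hξ.nonneg i).lt_of_ne' hi⟩

theorem exists_le_dotProduct (hξ : G.IsStationary ξ) (q : Fin n → ℝ) :
    ∃ i, 0 < ξ i ∧ q i ≤ ξ ⬝ᵥ q := by
  by_contra! hlt
  obtain ⟨k, hk⟩ := hξ.exists_pos
  have hsum : ∑ i, ξ i * ξ ⬝ᵥ q < ∑ i, ξ i * q i := by
    refine Finset.sum_lt_sum (fun i _ => ?_) ⟨k, Finset.mem_univ k,
      mul_lt_mul_of_pos_left (hlt k hk) hk⟩
    rcases (hξ.nonneg i).eq_or_lt with hi | hi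
    · simp [← hi]
    · exact (mul_lt_mul_of_pos_left (hlt i hi) hi).le
  rw [← Finset.sum_mul, hξ.sum_eq_one, one_mul] at hsum
  exact hsum.false

theorem exists_dotProduct_le (hξ : G.IsStationary ξ) (q : Fin n → ℝ) :
    ∃ i, 0 < ξ i ∧ ξ ⬝ᵥ q ≤ q i := by
  simpa [dotProduct_neg] using hξ.exists_le_dotProduct (-q)

theorem pos_of_link (hξ : G.IsStationary ξ) {i j : Fin n} (hij : G.Link j i) (hi : 0 < ξ i) :
    0 < ξ j := by
  refine (hξ.nonneg j).lt_of_ne' fun hj => ?_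
  have hterm : ∀ k, ξ k * G.laplacian k j = -(ξ k * G.weight k j) := fun k => by
    rcases eq_or_ne k j with rfl | hk
    · simp [hj]
    · rw [laplacian_of_ne hk, mul_neg]
  have hsum : ∑ k, ξ k * G.weight k j = 0 := by
    simpa [Matrix.vecMul, dotProduct, hterm] using congrFun hξ.vecMul_laplacian j
  rw [Finset.sum_eq_zero_iff_of_nonneg fun k _ =>
    mul_nonneg (hξ.nonneg k) (G.weight_nonneg k j)] at hsum
  exact (mul_pos hi hij).ne' (hsum i (Finset.mem_univ i))

theorem sq_sub_le_of_link (hξ : G.IsStationary ξ) {i j : Fin n} (hij : G.Link j i)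
    (hi : 0 < ξ i) (u : Fin n → ℝ) :
    (u i - u j) ^ 2 ≤ (ξ i * G.weight i j)⁻¹ * ξ ⬝ᵥ G.energy u := by
  rw [le_inv_mul_iff₀ (mul_pos hi hij), mul_assoc]
  calc ξ i * (G.weight i j * (u i - u j) ^ 2)
      ≤ ξ i * G.energy u i := mul_le_mul_of_nonneg_left
        (Finset.single_le_sum (f := fun j => G.weight i j * (u i - u j) ^ 2)
          (fun j _ => mul_nonneg (G.weight_nonneg i j) (sq_nonneg _)) (Finset.mem_univ j)) hi.le
    _ ≤ ξ ⬝ᵥ G.energy u :=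
        Finset.single_le_sum (f := fun i => ξ i * G.energy u i)
          (fun i _ => mul_nonneg (hξ.nonneg i) (energy_nonneg u i)) (Finset.mem_univ i)

theorem exists_sq_sub_le_of_reaches (hξ : G.IsStationary ξ) {i j : Fin n} (hij : G.Reaches j i)
    (hi : 0 < ξ i) : ∃ C, ∀ u, (u i - u j) ^ 2 ≤ C * ξ ⬝ᵥ G.energy u := by
  suffices h : 0 < ξ j ∧ ∃ C, ∀ u, (u i - u j) ^ 2 ≤ C * ξ ⬝ᵥ G.energy u from h.2
  induction hij using Relation.ReflTransGen.head_induction_on with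
  | refl => exact ⟨hi, 0, fun u => by simp⟩
  | @head j k hjk _ ih =>
    obtain ⟨hk, C, hC⟩ := ih
    refine ⟨hξ.pos_of_link hjk hk, 2 * (C + (ξ k * G.weight k j)⁻¹), fun u => ?_⟩
    calc (u i - u j) ^ 2 = ((u i - u k) + (u k - u j)) ^ 2 := by ring
      _ ≤ 2 * ((u i - u k) ^ 2 + (u k - u j) ^ 2) := add_sq_le
      _ ≤ 2 * (C * ξ ⬝ᵥ G.energy u + (ξ k * G.weight k j)⁻¹ * ξ ⬝ᵥ G.energy u) := by
        gcongr
        exacts [hC u, hξ.sq_sub_le_of_link hjk hk u]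
      _ = 2 * (C + (ξ k * G.weight k j)⁻¹) * ξ ⬝ᵥ G.energy u := by ring

theorem exists_sq_le_of_sign_change (hξ : G.IsStationary ξ) {r : Fin n}
    (hr : ∀ i, G.Reaches r i) :
    ∃ C ≥ 0, ∀ u, (∃ i, 0 < ξ i ∧ u i ≤ 0) → (∃ i, 0 < ξ i ∧ 0 ≤ u i) →
      u r ^ 2 ≤ C * ξ ⬝ᵥ G.energy u := by
  choose! C hC using fun i (hi : 0 < ξ i) => hξ.exists_sq_sub_le_of_reaches (hr i) hi
  obtain ⟨B, hB⟩ := (finite_range C).bddAbove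
  have hbound : ∀ i, 0 < ξ i → ∀ u, (u i - u r) ^ 2 ≤ max B 0 * ξ ⬝ᵥ G.energy u := fun i hi u =>
    (hC i hi u).trans (mul_le_mul_of_nonneg_right
      ((hB (mem_range_self i)).trans (le_max_left _ _)) (hξ.dotProduct_energy_nonneg u))
  refine ⟨max B 0, le_max_right _ _, fun u => ?_⟩
  rintro ⟨i, hi, hui⟩ ⟨j, hj, huj⟩
  rcases le_total 0 (u r) with hur | hur
  · exact le_trans (by nlinarith) (hbound i hi u)
  · exact le_trans (by nlinarith) (hbound j hj u)

end IsStationary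

/-- Weights `ζ` for which the quadratic form `∑ i, ζ i * u i * (L u) i` is coercive on the vectors
that change sign on the support of `ξ`; they are the weights of the Lyapunov function. -/
structure IsDissipationWeight (G : WeightedDigraph n) (ξ ζ : Fin n → ℝ) : Prop where
  nonneg : 0 ≤ ζ
  dotProduct_self_le : ∀ u, (∃ i, 0 < ξ i ∧ u i ≤ 0) → (∃ i, 0 < ξ i ∧ 0 ≤ u i) →
    u ⬝ᵥ u ≤ ζ ⬝ᵥ (u * G.laplacian *ᵥ u)

theorem dotProduct_self_sub_le_of_vecMul_pinnedLaplacian {ω : Fin n → ℝ} {r : Fin n}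
    (hω : 0 ≤ ω) (hωr : ω ᵥ* G.pinnedLaplacian r = 1) (u : Fin n → ℝ) :
    u ⬝ᵥ u - ω r * u r ^ 2 ≤ 2 * ω ⬝ᵥ (u * G.laplacian *ᵥ u) := by
  have hsq : ω ⬝ᵥ G.laplacian *ᵥ (u ^ 2) = u ⬝ᵥ u - ω r * u r ^ 2 := by
    rw [eq_sub_of_add_eq (pinnedLaplacian_mulVec r (u ^ 2)).symm, dotProduct_sub,
      Matrix.dotProduct_mulVec, hωr, dotProduct_single]
    simp [dotProduct, sq]
  rw [← smul_eq_mul 2, ← dotProduct_smul, two_mul_laplacian_mulVec, dotProduct_add, hsq]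
  exact le_add_of_nonneg_right (dotProduct_nonneg_of_nonneg hω (energy_nonneg u))

theorem IsStationary.exists_isDissipationWeight {ξ : Fin n → ℝ} (hξ : G.IsStationary ξ)
    (hG : G.HasSpanningTree) : ∃ ζ, G.IsDissipationWeight ξ ζ := by
  obtain ⟨r, hr⟩ := hG
  obtain ⟨ω, hω, hωr⟩ := exists_nonneg_vecMul_pinnedLaplacian hr
  obtain ⟨C, hC, hsq⟩ := hξ.exists_sq_le_of_sign_change hr
  refine ⟨(2 : ℝ) • ω + (2 * (ω r * C)) • ξ, ?_, fun u hneg hpos => ?_⟩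
  · exact add_nonneg (smul_nonneg zero_le_two hω)
      (smul_nonneg (mul_nonneg zero_le_two (mul_nonneg (hω r) hC)) hξ.nonneg)
  calc u ⬝ᵥ u
      ≤ u ⬝ᵥ u - ω r * u r ^ 2 + ω r * (C * ξ ⬝ᵥ G.energy u) := by
        linarith [mul_le_mul_of_nonneg_left (hsq u hneg hpos) (hω r)]
    _ ≤ 2 * ω ⬝ᵥ (u * G.laplacian *ᵥ u) + ω r * (C * ξ ⬝ᵥ G.energy u) := by
        gcongr
        exact dotProduct_self_sub_le_of_vecMul_pinnedLaplacian hω hωr u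
    _ = ((2 : ℝ) • ω + (2 * (ω r * C)) • ξ) ⬝ᵥ (u * G.laplacian *ᵥ u) := by
        rw [← hξ.two_mul_dotProduct_mul_laplacian_mulVec, add_dotProduct, smul_dotProduct,
          smul_dotProduct, smul_eq_mul, smul_eq_mul]
        ring

theorem IsDissipationWeight.dotProduct_mul_neg_laplacian_mulVec_add_le {ξ ζ : Fin n → ℝ}
    (hζ : G.IsDissipationWeight ξ ζ) {u : Fin n → ℝ} (hneg : ∃ i, 0 < ξ i ∧ u i ≤ 0)
    (hpos : ∃ i, 0 < ξ i ∧ 0 ≤ u i) (v : Fin n → ℝ) :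
    ζ ⬝ᵥ (u * -(G.laplacian *ᵥ (u + v))) ≤
      -(u ⬝ᵥ u) + (∑ i, ζ i) * (‖u‖ * (‖G.laplacian‖ * ‖v‖)) := by
  have herr : ζ ⬝ᵥ (u * -(G.laplacian *ᵥ v)) ≤
      (∑ i, ζ i) * (‖u‖ * (‖G.laplacian‖ * ‖v‖)) := by
    rw [Finset.sum_mul]
    refine Finset.sum_le_sum fun i _ => mul_le_mul_of_nonneg_left ?_ (hζ.nonneg i)
    calc (u * -(G.laplacian *ᵥ v)) i ≤ ‖u * -(G.laplacian *ᵥ v)‖ :=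
          (Real.le_norm_self _).trans (norm_le_pi_norm _ i)
      _ ≤ ‖u‖ * ‖-(G.laplacian *ᵥ v)‖ := norm_mul_le _ _
      _ ≤ ‖u‖ * (‖G.laplacian‖ * ‖v‖) := by
        rw [norm_neg]
        gcongr
        exact Matrix.linfty_opNorm_mulVec _ _
  rw [Matrix.mulVec_add, neg_add, mul_add, dotProduct_add, mul_neg, dotProduct_neg]
  exact add_le_add (neg_le_neg (hζ.dotProduct_self_le u hneg hpos)) herr

section Perron

theorem sum_extend_val_smul {V : Type*} [AddCommMonoid V] [Module ℝ V] {P : Fin n → Prop}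
    [DecidablePred P] (ξ : {i // P i} → ℝ) (z : Fin n → V) :
    ∑ i, Function.extend Subtype.val ξ 0 i • z i = ∑ i, ξ i • z i.1 :=
  (Fintype.sum_of_injective Subtype.val Subtype.val_injective _ _
    (fun i hi => by rw [Function.extend_apply' _ _ _ hi, Pi.zero_apply, zero_smul])
    (fun i => by rw [Subtype.val_injective.extend_apply])).symm

variable {M : ℕ} {c : Fin n → Fin (M + 1)}

theorem IsPerronFrobeniusForm.blockTilde_last (hc : G.IsPerronFrobeniusForm c) :
    G.blockTilde c (Fin.last M) = G.block c (Fin.last M) := by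
  ext i j
  unfold blockTilde
  split_ifs with hij
  · subst hij
    have hrow : ∑ k, G.block c (Fin.last M) i k = 0 :=
      (Fintype.sum_of_injective Subtype.val Subtype.val_injective _ _
        (fun k hk => hc.upper i.1 k (i.2.symm ▸ Fin.lt_last_iff_ne_last.mpr fun hck =>
          hk ⟨⟨k, hck⟩, rfl⟩))
        fun _ => rfl).trans (sum_laplacian i.1)
    rw [← Finset.add_sum_erase _ _ (Finset.mem_univ i)] at hrow
    linarith
  · rfl

theorem IsPerronVector.isStationary_extend {ξ : {i // c i = Fin.last M} → ℝ}
    (hξ : G.IsPerronVector c (Fin.last M) ξ) (hc : G.IsPerronFrobeniusForm c) :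
    G.IsStationary (Function.extend Subtype.val ξ 0) where
  nonneg i := by
    by_cases hi : ∃ j : {i // c i = Fin.last M}, j.1 = i
    · obtain ⟨j, rfl⟩ := hi
      rw [Subtype.val_injective.extend_apply]
      exact (hξ.pos j).le
    · rw [Function.extend_apply' _ _ _ hi]
  sum_eq_one := by simpa [hξ.sum_eq_one] using sum_extend_val_smul ξ fun _ => (1 : ℝ)
  vecMul_laplacian := by
    ext j
    refine (sum_extend_val_smul ξ fun i => G.laplacian i j).trans ?_
    by_cases hj : c j = Fin.last M
    · have hnull := congrFun hξ.left_null ⟨j, hj⟩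
      rwa [hc.blockTilde_last] at hnull
    · refine Finset.sum_eq_zero fun i _ => ?_
      rw [hc.upper i.1 j (i.2.symm ▸ Fin.lt_last_iff_ne_last.mpr hj), smul_zero]

end Perron

end WeightedDigraph

/-- A solution `y` of the differential equation `y' = -L (f(y) + e)` on `I`, where the perturbation
`e` of the output is bounded by `κ`. Since `e` may jump, `y'` is the right derivative. Each
coordinate of the closed-loop system is of this form, `e` being the sampling error. -/
structure IsPerturbedFlow {n : ℕ} (G : WeightedDigraph n) (f κ : ℝ → ℝ) (I : Set ℝ)
    (y e : ℝ → Fin n → ℝ) : Prop where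
  continuousOn : ContinuousOn y I
  hasDerivWithinAt : ∀ t ∈ I,
    HasDerivWithinAt y (-(G.laplacian *ᵥ (f ∘ y t + e t))) (Ici t) t
  norm_error_le : ∀ t ∈ I, ‖e t‖ ≤ κ t

section Potential

variable {f : ℝ → ℝ}

/-- The convex function with derivative `f - f θ` and minimum at `θ`; its weighted sum over the
agents is the Lyapunov function. -/
noncomputable def potential (f : ℝ → ℝ) (θ x : ℝ) : ℝ := ∫ s in θ..x, (f s - f θ)

theorem hasDerivAt_potential (hf : Continuous f) (θ x : ℝ) :
    HasDerivAt (potential f θ) (f x - f θ) x :=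
  (hf.sub continuous_const).integral_hasStrictDerivAt θ x |>.hasDerivAt

theorem potential_nonneg (hf : Monotone f) (θ x : ℝ) : 0 ≤ potential f θ x := by
  rcases le_total θ x with h | h
  · exact intervalIntegral.integral_nonneg h fun s hs => sub_nonneg.mpr (hf hs.1)
  · rw [potential, intervalIntegral.integral_symm, ← intervalIntegral.integral_neg]
    exact intervalIntegral.integral_nonneg h fun s hs =>
      neg_nonneg.mpr (sub_nonpos.mpr (hf hs.2))

/-- The deviations of the outputs of all agents from the output at `θ`. -/
def outputDeviation {n : ℕ} (f : ℝ → ℝ) (θ : ℝ) (u : Fin n → ℝ) : Fin n → ℝ :=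
  fun i => f (u i) - f θ

theorem continuous_outputDeviation {n : ℕ} (hf : Continuous f) (θ : ℝ) :
    Continuous (outputDeviation f θ : (Fin n → ℝ) → Fin n → ℝ) := by
  unfold outputDeviation
  fun_prop

end Potential

theorem exists_abs_sub_lt_of_monotone {f : ℝ → ℝ} (hf : Monotone f) {θ : ℝ}
    (hθ : ∀ x, f x = f θ → x = θ) {ε : ℝ} (hε : 0 < ε) :
    ∃ δ > 0, ∀ x, |f x - f θ| < δ → |x - θ| < ε := by
  have hup : f θ < f (θ + ε) := (hf (by linarith)).lt_of_ne' fun h => by linarith [hθ _ h]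
  have hdown : f (θ - ε) < f θ := (hf (by linarith)).lt_of_ne fun h => by linarith [hθ _ h]
  refine ⟨min (f (θ + ε) - f θ) (f θ - f (θ - ε)),
    lt_min (sub_pos.mpr hup) (sub_pos.mpr hdown), fun x hx => ?_⟩
  rw [lt_min_iff, abs_lt, abs_lt] at hx
  rw [abs_sub_lt_iff]
  have hlt : x < θ + ε := hf.reflect_lt (by linarith [hx.1.2])
  have hgt : θ - ε < x := hf.reflect_lt (by linarith [hx.2.1])
  exact ⟨by linarith, by linarith⟩

namespace IsPerturbedFlow

variable {n : ℕ} {G : WeightedDigraph n} {f κ E : ℝ → ℝ} {I : Set ℝ} {y e : ℝ → Fin n → ℝ}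
  {a b θ : ℝ}

theorem mono (H : IsPerturbedFlow G f κ I y e) {J : Set ℝ} (hJ : J ⊆ I) :
    IsPerturbedFlow G f κ J y e :=
  ⟨H.continuousOn.mono hJ, fun t ht => H.hasDerivWithinAt t (hJ ht),
    fun t ht => H.norm_error_le t (hJ ht)⟩

theorem neg (H : IsPerturbedFlow G f κ I y e) :
    IsPerturbedFlow G (fun x => -f (-x)) κ I (-y) (-e) where
  continuousOn := H.continuousOn.neg
  hasDerivWithinAt t ht := by
    refine (H.hasDerivWithinAt t ht).neg.congr_deriv (congrArg _ ?_)
    rw [← Matrix.mulVec_neg]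
    congr 1
    ext i
    simp [add_comm]
  norm_error_le t ht := by simpa using H.norm_error_le t ht

theorem norm_laplacian_mulVec_error_le (H : IsPerturbedFlow G f κ I y e) {t : ℝ} (ht : t ∈ I) :
    ‖G.laplacian *ᵥ e t‖ ≤ ‖G.laplacian‖ * κ t :=
  (Matrix.linfty_opNorm_mulVec _ _).trans
    (mul_le_mul_of_nonneg_left (H.norm_error_le t ht) (norm_nonneg _))

section Bounds

variable (hf : Monotone f) (hE : ∀ t, HasDerivAt E (-κ t) t)

include hf hE

theorem le_add (H : IsPerturbedFlow G f κ (Icc a b) y e) (hab : a ≤ b)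
    (ha : ∀ i, y a i ≤ θ) (i : Fin n) : y b i ≤ θ + ‖G.laplacian‖ * (E a - E b) := by
  have hB : ∀ t, HasDerivAt (fun t => θ + ‖G.laplacian‖ * (E a - E t)) (‖G.laplacian‖ * κ t) t :=
    fun t => by simpa using (((hE t).const_sub (E a)).const_mul ‖G.laplacian‖).const_add θ
  refine image_le_of_deriv_right_le_at_max H.continuousOn
    (fun t ht => H.hasDerivWithinAt t (Ico_subset_Icc_self ht)) (by simpa using ha)
    (fun t _ => (hB t).continuousAt.continuousWithinAt) (fun t _ => (hB t).hasDerivWithinAt)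
    (fun t ht j hj => ?_) (right_mem_Icc.mpr hab) i
  have hmax : 0 ≤ (G.laplacian *ᵥ (f ∘ y t)) j :=
    WeightedDigraph.laplacian_mulVec_nonneg_of_forall_le fun k => hf (hj k)
  have herr : -(G.laplacian *ᵥ e t) j ≤ ‖G.laplacian‖ * κ t :=
    (neg_le_abs _).trans ((norm_le_pi_norm _ j).trans
      (H.norm_laplacian_mulVec_error_le (Ico_subset_Icc_self ht)))
  rw [Pi.neg_apply, Matrix.mulVec_add, Pi.add_apply]
  linarith

theorem abs_sub_le (H : IsPerturbedFlow G f κ (Icc a b) y e) (hab : a ≤ b) {ρ : ℝ}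
    (ha : ∀ i, |y a i - θ| ≤ ρ) (i : Fin n) :
    |y b i - θ| ≤ ρ + ‖G.laplacian‖ * (E a - E b) := by
  have hmono : Monotone fun x => -f (-x) := fun x x' h => neg_le_neg (hf (neg_le_neg h))
  have hupper := H.le_add hf hE hab (θ := θ + ρ) (fun j => by linarith [(abs_le.mp (ha j)).2]) i
  have hlower := H.neg.le_add hmono hE hab (θ := ρ - θ)
    (fun j => by simp only [Pi.neg_apply]; linarith [(abs_le.mp (ha j)).1]) i
  simp only [Pi.neg_apply] at hlower
  rw [abs_sub_le_iff]
  exact ⟨by linarith, by linarith⟩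

theorem exists_norm_le (H : IsPerturbedFlow G f κ I y e) (hE0 : ∀ t, 0 ≤ E t)
    (hI : I.OrdConnected) (ha : IsLeast I a) : ∃ R, ∀ t ∈ I, ‖y t‖ ≤ R := by
  refine ⟨‖y a‖ + ‖G.laplacian‖ * E a, fun t ht => ?_⟩
  have hEa := mul_nonneg (norm_nonneg G.laplacian) (hE0 a)
  refine (pi_norm_le_iff_of_nonneg (by positivity)).mpr fun i => ?_
  have hi := (H.mono (hI.out ha.1 ht)).abs_sub_le hf hE (ha.2 ht) (θ := 0)
    (fun j => by simpa using norm_le_pi_norm (y a) j) i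
  rw [sub_zero] at hi
  have hEt := mul_nonneg (norm_nonneg G.laplacian) (hE0 t)
  rw [Real.norm_eq_abs]
  linarith

theorem exists_norm_comp_le (H : IsPerturbedFlow G f κ I y e) (hE0 : ∀ t, 0 ≤ E t)
    (hI : I.OrdConnected) (ha : IsLeast I a) {F : (Fin n → ℝ) → Fin n → ℝ} (hF : Continuous F) :
    ∃ C, ∀ t ∈ I, ‖F (y t)‖ ≤ C := by
  obtain ⟨R, hR⟩ := H.exists_norm_le hf hE hE0 hI ha
  obtain ⟨C, hC⟩ := (isCompact_closedBall (0 : Fin n → ℝ) R).exists_bound_of_continuousOn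
    hF.continuousOn
  exact ⟨C, fun t ht => hC _ (mem_closedBall_zero_iff.mpr (hR t ht))⟩

theorem exists_lipschitzOnWith (H : IsPerturbedFlow G f κ I y e) (hfc : Continuous f)
    (hE0 : ∀ t, 0 ≤ E t) (hI : I.OrdConnected) (ha : IsLeast I a) {κ₀ : ℝ}
    (hκ : ∀ t ∈ I, κ t ≤ κ₀) : ∃ K, LipschitzOnWith K y I := by
  obtain ⟨C, hC⟩ := H.exists_norm_comp_le hf hE hE0 hI ha
    (F := fun u => f ∘ u) (by unfold Function.comp; fun_prop)
  have hderiv : ∀ t ∈ I, ‖-(G.laplacian *ᵥ (f ∘ y t + e t))‖ ≤ ‖G.laplacian‖ * (C + κ₀) :=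
    fun t ht => by
      rw [norm_neg]
      refine (Matrix.linfty_opNorm_mulVec _ _).trans ?_
      gcongr
      exact (norm_add_le _ _).trans
        (add_le_add (hC t ht) ((H.norm_error_le t ht).trans (hκ t ht)))
  refine ⟨(‖G.laplacian‖ * (C + κ₀)).toNNReal, LipschitzOnWith.of_dist_le' fun s hs t ht => ?_⟩
  wlog hst : s ≤ t generalizing s t
  · rw [dist_comm, dist_comm s]
    exact this t ht s hs (le_of_not_ge hst)
  rw [dist_comm, dist_comm s, dist_eq_norm, Real.dist_eq, abs_of_nonneg (sub_nonneg.mpr hst)]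
  have hsub := hI.out hs ht
  exact norm_image_sub_le_of_norm_deriv_right_le_segment (H.continuousOn.mono hsub)
    (fun r hr => H.hasDerivWithinAt r (hsub (Ico_subset_Icc_self hr)))
    (fun r hr => hderiv r (hsub (Ico_subset_Icc_self hr))) t (right_mem_Icc.mpr hst)

theorem uniformContinuousOn_comp (H : IsPerturbedFlow G f κ I y e) (hfc : Continuous f)
    (hE0 : ∀ t, 0 ≤ E t) (hI : I.OrdConnected) (ha : IsLeast I a) {κ₀ : ℝ}
    (hκ : ∀ t ∈ I, κ t ≤ κ₀) : UniformContinuousOn (fun t => f ∘ y t) I := by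
  obtain ⟨R, hR⟩ := H.exists_norm_le hf hE hE0 hI ha
  obtain ⟨K, hK⟩ := H.exists_lipschitzOnWith hf hE hfc hE0 hI ha hκ
  have hcont : Continuous fun u : Fin n → ℝ => f ∘ u := by unfold Function.comp; fun_prop
  exact ((isCompact_closedBall (0 : Fin n → ℝ) R).uniformContinuousOn_of_continuous
    hcont.continuousOn).comp hK.uniformContinuousOn
    fun t ht => mem_closedBall_zero_iff.mpr (hR t ht)

end Bounds

variable {ξ ζ : Fin n → ℝ}

theorem dotProduct_eq (H : IsPerturbedFlow G f κ (Icc a b) y e) (hξ : G.IsStationary ξ)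
    (hab : a ≤ b) : ξ ⬝ᵥ y b = ξ ⬝ᵥ y a := by
  refine constant_of_has_deriv_right_zero (f := fun t => ξ ⬝ᵥ y t) ?_ (fun t ht => ?_) b
    (right_mem_Icc.mpr hab)
  · exact continuousOn_finsetSum _ fun i _ =>
      continuousOn_const.mul (continuousOn_pi.mp H.continuousOn i)
  · have hy := hasDerivWithinAt_pi.mp (H.hasDerivWithinAt t (Ico_subset_Icc_self ht))
    refine (HasDerivWithinAt.fun_sum fun i _ => (hy i).const_mul (ξ i)).congr_deriv ?_
    change ξ ⬝ᵥ -(G.laplacian *ᵥ (f ∘ y t + e t)) = 0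
    rw [dotProduct_neg, hξ.dotProduct_laplacian_mulVec, neg_zero]

theorem hasDerivWithinAt_dotProduct_potential (H : IsPerturbedFlow G f κ I y e)
    (hf : Continuous f) {t : ℝ} (ht : t ∈ I) :
    HasDerivWithinAt (fun s => ζ ⬝ᵥ (potential f θ ∘ y s))
      (ζ ⬝ᵥ (outputDeviation f θ (y t) * -(G.laplacian *ᵥ (outputDeviation f θ (y t) + e t))))
      (Ici t) t := by
  have hconst : G.laplacian *ᵥ (outputDeviation f θ (y t) + e t) =
      G.laplacian *ᵥ (f ∘ y t + e t) := by
    rw [← WeightedDigraph.laplacian_mulVec_add_const _ (f θ)]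
    congr 1
    ext i
    simp only [Pi.add_apply, outputDeviation, Function.comp_apply]
    ring
  have hy := hasDerivWithinAt_pi.mp (H.hasDerivWithinAt t ht)
  rw [hconst]
  exact HasDerivWithinAt.fun_sum fun i _ =>
    ((hasDerivAt_potential hf θ (y t i)).comp_hasDerivWithinAt t (hy i)).const_mul (ζ i)

theorem dotProduct_outputDeviation_mul_le (H : IsPerturbedFlow G f κ I y e) (hf : Monotone f)
    (hζ : G.IsDissipationWeight ξ ζ) (hξ : G.IsStationary ξ) {t : ℝ} (ht : t ∈ I) {C : ℝ}
    (hC : ‖outputDeviation f (ξ ⬝ᵥ y t) (y t)‖ ≤ C) :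
    ζ ⬝ᵥ (outputDeviation f (ξ ⬝ᵥ y t) (y t) *
        -(G.laplacian *ᵥ (outputDeviation f (ξ ⬝ᵥ y t) (y t) + e t))) ≤
      -(outputDeviation f (ξ ⬝ᵥ y t) (y t) ⬝ᵥ outputDeviation f (ξ ⬝ᵥ y t) (y t)) +
        (∑ i, ζ i) * (C * ‖G.laplacian‖) * κ t := by
  obtain ⟨i, hi, hiy⟩ := hξ.exists_le_dotProduct (y t)
  obtain ⟨j, hj, hjy⟩ := hξ.exists_dotProduct_le (y t)
  refine (hζ.dotProduct_mul_neg_laplacian_mulVec_add_le ⟨i, hi, sub_nonpos.mpr (hf hiy)⟩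
    ⟨j, hj, sub_nonneg.mpr (hf hjy)⟩ (e t)).trans ?_
  rw [mul_assoc, mul_assoc]
  have hζ0 : 0 ≤ ∑ i, ζ i := Finset.sum_nonneg fun i _ => hζ.nonneg i
  have hC0 := (norm_nonneg _).trans hC
  gcongr
  exact H.norm_error_le t ht

theorem dotProduct_potential_le (H : IsPerturbedFlow G f κ (Icc a b) y e) (hf : Monotone f)
    (hfc : Continuous f) (hE : ∀ t, HasDerivAt E (-κ t) t) (hζ : G.IsDissipationWeight ξ ζ)
    (hξ : G.IsStationary ξ) (hab : a ≤ b) (hθ : ξ ⬝ᵥ y a = θ) {C δ : ℝ}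
    (hC : ∀ t ∈ Icc a b, ‖outputDeviation f θ (y t)‖ ≤ C)
    (hδ : ∀ t ∈ Icc a b, δ ≤ outputDeviation f θ (y t) ⬝ᵥ outputDeviation f θ (y t)) :
    ζ ⬝ᵥ (potential f θ ∘ y b) ≤ ζ ⬝ᵥ (potential f θ ∘ y a) - δ * (b - a) +
      (∑ i, ζ i) * (C * ‖G.laplacian‖) * (E a - E b) := by
  set c := (∑ i, ζ i) * (C * ‖G.laplacian‖)
  have hB : ∀ t, HasDerivAt (fun t => ζ ⬝ᵥ (potential f θ ∘ y a) - δ * (t - a) + c * (E a - E t))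
      (-δ + c * κ t) t := fun t => by
    simpa using ((((hasDerivAt_id t).sub_const a).const_mul δ).const_sub
      (ζ ⬝ᵥ (potential f θ ∘ y a))).fun_add (((hE t).const_sub (E a)).const_mul c)
  have hpot : Continuous (potential f θ) :=
    continuous_iff_continuousAt.mpr fun x => (hasDerivAt_potential hfc θ x).continuousAt
  refine image_le_of_deriv_right_le_deriv_boundary
    (f := fun t => ζ ⬝ᵥ (potential f θ ∘ y t)) ?_
    (fun t ht => H.hasDerivWithinAt_dotProduct_potential hfc (Ico_subset_Icc_self ht)) (by simp)
    (fun t _ => (hB t).continuousAt.continuousWithinAt) (fun t _ => (hB t).hasDerivWithinAt)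
    (fun t ht => ?_) (right_mem_Icc.mpr hab)
  · exact continuousOn_finsetSum _ fun i _ => continuousOn_const.mul
      (hpot.comp_continuousOn (continuousOn_pi.mp H.continuousOn i))
  · have htI := Ico_subset_Icc_self ht
    obtain rfl : ξ ⬝ᵥ y t = θ :=
      ((H.mono (Icc_subset_Icc_right ht.2.le)).dotProduct_eq hξ ht.1).trans hθ
    linarith [H.dotProduct_outputDeviation_mul_le hf hζ hξ htI (hC t htI), hδ t htI]

theorem exists_outputDeviation_dotProduct_self_lt (H : IsPerturbedFlow G f κ (Ici a) y e)
    (hf : Monotone f) (hfc : Continuous f) (hE : ∀ t, HasDerivAt E (-κ t) t)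
    (hE0 : ∀ t, 0 ≤ E t) (hζ : G.IsDissipationWeight ξ ζ) (hξ : G.IsStationary ξ)
    (hθ : ξ ⬝ᵥ y a = θ) {b : ℝ} (hab : a ≤ b) {δ : ℝ} (hδ : 0 < δ) :
    ∃ t ≥ b, outputDeviation f θ (y t) ⬝ᵥ outputDeviation f θ (y t) < δ := by
  by_contra! hlarge
  obtain ⟨C, hC⟩ := H.exists_norm_comp_le hf hE hE0 ordConnected_Ici isLeast_Ici
    (continuous_outputDeviation hfc θ)
  have hC0 : 0 ≤ C := (norm_nonneg _).trans (hC a self_mem_Ici)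
  have hpot : ∀ t, 0 ≤ ζ ⬝ᵥ (potential f θ ∘ y t) := fun t =>
    dotProduct_nonneg_of_nonneg hζ.nonneg fun i => potential_nonneg hf θ (y t i)
  set c := (∑ i, ζ i) * (C * ‖G.laplacian‖)
  have hc : 0 ≤ c := mul_nonneg (Finset.sum_nonneg fun i _ => hζ.nonneg i)
    (mul_nonneg hC0 (norm_nonneg _))
  set V := ζ ⬝ᵥ (potential f θ ∘ y b) + c * E b
  have hV : 0 ≤ V := add_nonneg (hpot b) (mul_nonneg hc (hE0 b))
  set t := b + (V + 1) / δ
  have hbt : b ≤ t := le_add_of_nonneg_right (by positivity)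
  have hθb : ξ ⬝ᵥ y b = θ := ((H.mono Icc_subset_Ici_self).dotProduct_eq hξ hab).trans hθ
  have hsub : Icc b t ⊆ Ici a := Icc_subset_Ici_self.trans (Ici_subset_Ici.mpr hab)
  have hdecay := (H.mono hsub).dotProduct_potential_le hf hfc hE hζ hξ hbt hθb
    (fun s hs => hC s (hsub hs)) fun s hs => hlarge s hs.1
  have hdrop : δ * (t - b) = V + 1 := by simp [t, mul_div_cancel₀ _ hδ.ne']
  linarith [hpot t, mul_nonneg hc (hE0 t)]

theorem tendsto_dotProduct (H : IsPerturbedFlow G f κ (Ici a) y e) (hf : Monotone f)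
    (hfc : Continuous f) (hE : ∀ t, HasDerivAt E (-κ t) t) (hE0 : ∀ t, 0 ≤ E t)
    (hElim : Tendsto E atTop (𝓝 0)) (hG : G.HasSpanningTree) (hξ : G.IsStationary ξ)
    (hθ : ∀ x, f x = f (ξ ⬝ᵥ y a) → x = ξ ⬝ᵥ y a) (i : Fin n) :
    Tendsto (fun t => y t i) atTop (𝓝 (ξ ⬝ᵥ y a)) := by
  obtain ⟨ζ, hζ⟩ := hξ.exists_isDissipationWeight hG
  refine Metric.tendsto_atTop.mpr fun ε hε => ?_
  obtain ⟨δ, hδ, hclose⟩ := exists_abs_sub_lt_of_monotone hf hθ (half_pos hε)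
  have htail : ∀ᶠ t in atTop, ‖G.laplacian‖ * E t < ε / 2 := by
    have hlim := hElim.const_mul ‖G.laplacian‖
    rw [mul_zero] at hlim
    exact hlim.eventually_lt_const (half_pos hε)
  obtain ⟨b, hb, hab⟩ :=
    ((eventually_forall_ge_atTop.mpr htail).and (eventually_ge_atTop a)).exists
  obtain ⟨t₀, ht₀, hdev⟩ :=
    H.exists_outputDeviation_dotProduct_self_lt hf hfc hE hE0 hζ hξ rfl hab (pow_pos hδ 2)
  have hstart : ∀ j, |y t₀ j - ξ ⬝ᵥ y a| ≤ ε / 2 := fun j => by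
    refine (hclose _ (abs_lt_of_sq_lt_sq (lt_of_le_of_lt ?_ hdev) hδ.le)).le
    rw [sq]
    exact Finset.single_le_sum (fun k _ => mul_self_nonneg (outputDeviation f _ (y t₀) k))
      (Finset.mem_univ j)
  refine ⟨t₀, fun t ht => ?_⟩
  have hsub : Icc t₀ t ⊆ Ici a := fun s hs => hab.trans (ht₀.trans hs.1)
  have hbound := (H.mono hsub).abs_sub_le hf hE ht hstart i
  rw [Real.dist_eq]
  linarith [hb t₀ ht₀, mul_nonneg (norm_nonneg G.laplacian) (hE0 t)]

end IsPerturbedFlow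

section ErrorEnvelope

variable {n : ℕ} {α β : Fin n → ℝ}

/-- A common bound for the sampling errors of the outputs of all agents at time `t`. -/
noncomputable def errorEnvelope (α β : Fin n → ℝ) (t : ℝ) : ℝ :=
  ∑ j, √(α j) * Real.exp (-(β j / 2) * t)

/-- The integral of `errorEnvelope` over `[t, ∞)`, if all `β j` are positive. -/
noncomputable def errorTail (α β : Fin n → ℝ) (t : ℝ) : ℝ :=
  ∑ j, √(α j) * (2 / β j) * Real.exp (-(β j / 2) * t)

theorem le_errorEnvelope {t u : ℝ} (j : Fin n) (hu : u ^ 2 ≤ α j * Real.exp (-β j * t)) :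
    u ≤ errorEnvelope α β t := by
  have hexp : Real.exp (-β j * t) = Real.exp (-(β j / 2) * t) ^ 2 := by
    rw [← Real.exp_nat_mul]
    congr 1
    push_cast
    ring
  calc u ≤ √(α j * Real.exp (-β j * t)) := Real.le_sqrt_of_sq_le hu
    _ = √(α j) * Real.exp (-(β j / 2) * t) := by
      rw [hexp, Real.sqrt_mul' _ (sq_nonneg _), Real.sqrt_sq (Real.exp_pos _).le]
    _ ≤ errorEnvelope α β t :=
      Finset.single_le_sum (f := fun j => √(α j) * Real.exp (-(β j / 2) * t))
        (fun _ _ => by positivity) (Finset.mem_univ j)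

variable (hβ : ∀ i, 0 < β i)

include hβ

theorem errorEnvelope_le {t : ℝ} (ht : 0 ≤ t) : errorEnvelope α β t ≤ errorEnvelope α β 0 := by
  refine Finset.sum_le_sum fun j _ => mul_le_mul_of_nonneg_left ?_ (Real.sqrt_nonneg _)
  rw [Real.exp_le_exp]
  nlinarith [hβ j]

theorem hasDerivAt_errorTail (t : ℝ) :
    HasDerivAt (errorTail α β) (-errorEnvelope α β t) t := by
  have hterm : ∀ j, HasDerivAt (fun t => √(α j) * (2 / β j) * Real.exp (-(β j / 2) * t))
      (-(√(α j) * Real.exp (-(β j / 2) * t))) t := fun j => by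
    refine ((((hasDerivAt_id t).const_mul _).exp).const_mul _).congr_deriv ?_
    have := (hβ j).ne'
    simp only [id_eq]
    field_simp
  exact (HasDerivAt.fun_sum fun j _ => hterm j).congr_deriv (Finset.sum_neg_distrib _)

theorem errorTail_nonneg (t : ℝ) : 0 ≤ errorTail α β t :=
  Finset.sum_nonneg fun j _ => by
    have := hβ j
    positivity

theorem tendsto_errorTail : Tendsto (errorTail α β) atTop (𝓝 0) := by
  have hexp : ∀ j, Tendsto (fun t => Real.exp (-(β j / 2) * t)) atTop (𝓝 0) := fun j =>
    Real.tendsto_exp_atBot.comp (tendsto_id.const_mul_atTop_of_neg (by linarith [hβ j]))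
  have hsum : Tendsto (errorTail α β) atTop (𝓝 (∑ j, √(α j) * (2 / β j) * 0)) :=
    tendsto_finsetSum _ fun j _ => (hexp j).const_mul _
  simpa only [mul_zero, Finset.sum_const_zero] using hsum

end ErrorEnvelope

section Horizon

/-- The time interval `[0, T)`. -/
def horizon (T : EReal) : Set ℝ := {t | 0 ≤ t ∧ (t : EReal) < T}

theorem ordConnected_horizon (T : EReal) : (horizon T).OrdConnected :=
  ⟨fun _ ha _ hb _ ht => ⟨ha.1.trans ht.1, (EReal.coe_le_coe_iff.mpr ht.2).trans_lt hb.2⟩⟩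

theorem isLeast_horizon {T : EReal} (hT : 0 < T) : IsLeast (horizon T) 0 :=
  ⟨⟨le_rfl, by simpa using hT⟩, fun _ ht => ht.1⟩

theorem horizon_top : horizon ⊤ = Ici 0 := by
  ext t
  simp [horizon, EReal.coe_lt_top]

end Horizon

theorem le_apply_of_isGreatest {φ ψ : ℝ → ℝ} (hφ : Continuous φ) (hψ : Continuous ψ) {a b : ℝ}
    (hb : IsGreatest {r | a ≤ r ∧ ∀ s ∈ Icc a r, φ s ≤ ψ s} b) : ψ b ≤ φ b := by
  by_contra! hlt
  have hnear : {s | φ s ≤ ψ s} ∈ 𝓝[≥] b := nhdsWithin_le_nhds <|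
    (hφ.continuousAt.eventually_lt hψ.continuousAt hlt).mono fun _ => le_of_lt
  obtain ⟨r, hbr, hr⟩ := mem_nhdsGE_iff_exists_Icc_subset.mp hnear
  refine hbr.not_ge (hb.2 ⟨hb.1.1.trans hbr.le, fun s hs => ?_⟩)
  rcases le_total s b with hsb | hbs
  · exact hb.1.2 s ⟨hs.1, hsb⟩
  · exact hr ⟨hbs, hs.2⟩

theorem continuous_output {p : ℕ} {g : Fin p → ℝ → ℝ} (hg : ∀ l, Continuous (g l)) :
    Continuous (output g) :=
  (PiLp.continuous_toLp 2 _).comp <| continuous_pi fun l =>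
    (hg l).comp (EuclideanSpace.proj (𝕜 := ℝ) l).continuous

namespace IsTrajectory

variable {n p : ℕ} {G : WeightedDigraph n} {g : Fin p → ℝ → ℝ} {α β : Fin n → ℝ} {T : EReal}
  {x : Fin n → ℝ → EuclideanSpace ℝ (Fin p)} {τ : Fin n → ℕ → EReal}

theorem exists_eq_coe (hx : IsTrajectory G g α β T x τ) {i : Fin n} {k : ℕ} {t : ℝ}
    (h : τ i k ≤ t) : ∃ a : ℝ, 0 ≤ a ∧ a ≤ t ∧ τ i k = a := by
  have hnonneg : 0 ≤ τ i k := hx.first i ▸ hx.monotone i (Nat.zero_le k)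
  lift τ i k to ℝ using ⟨ne_top_of_le_ne_top (EReal.coe_ne_top t) h,
    ne_bot_of_le_ne_bot EReal.zero_ne_bot hnonneg⟩ with a
  exact ⟨a, EReal.coe_nonneg.mp hnonneg, EReal.coe_le_coe_iff.mp h, rfl⟩

theorem lastIndex_spec (hx : IsTrajectory G g α β T x τ) (i : Fin n) {t : ℝ}
    (ht : t ∈ horizon T) :
    τ i (lastIndex (τ i) t) ≤ t ∧ (t : EReal) < τ i (lastIndex (τ i) t + 1) := by
  have hbdd := hx.last i t ht.1 ht.2
  refine ⟨Nat.sSup_mem (s := {k | τ i k ≤ t}) ⟨0, ?_⟩ hbdd, ?_⟩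
  · rw [mem_ofPred_eq, hx.first i]
    exact EReal.coe_nonneg.mpr ht.1
  · by_contra! hnext
    exact (Nat.lt_succ_self _).not_ge (le_csSup hbdd hnext)

theorem errorBound_sampled (hx : IsTrajectory G g α β T x τ) (i : Fin n) {t : ℝ}
    (ht : t ∈ horizon T) :
    ‖output g (sampled (x i) (τ i) t) - output g (x i t)‖ ^ 2 ≤ α i * Real.exp (-β i * t) := by
  obtain ⟨hlast, hnext⟩ := hx.lastIndex_spec i ht
  obtain ⟨a, -, hat, ha⟩ := hx.exists_eq_coe hlast
  rw [sampled, ha, EReal.toReal_coe]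
  rcases hx.trigger i _ a ha ((EReal.coe_le_coe_iff.mpr hat).trans_lt ht.2) with
    ⟨b, hb, -, z, -, hz, hmax⟩ | ⟨-, hall⟩
  · rw [hb, EReal.coe_lt_coe_iff] at hnext
    rw [← hz ⟨le_rfl, hat.trans hnext.le⟩, ← hz ⟨hat, hnext.le⟩]
    exact hmax.1.2 t ⟨hat, hnext.le⟩
  · exact hall t hat ht.2

theorem le_sq_norm_output_sub (hx : IsTrajectory G g α β T x τ) (hg : ∀ l, Continuous (g l))
    {i : Fin n} {k : ℕ} {a b : ℝ} (ha : τ i k = a) (hb : τ i (k + 1) = b) (hbT : (b : EReal) < T) :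
    α i * Real.exp (-β i * b) ≤ ‖output g (x i a) - output g (x i b)‖ ^ 2 := by
  have hab : (a : EReal) ≤ b := ha ▸ hb ▸ hx.monotone i (Nat.le_succ k)
  rcases hx.trigger i k a ha (hab.trans_lt hbT) with ⟨b', hb', -, z, hzc, hz, hmax⟩ | ⟨hT, -⟩
  · obtain rfl : b = b' := EReal.coe_injective (hb.symm.trans hb')
    rw [← hz ⟨le_rfl, EReal.coe_le_coe_iff.mp hab⟩, ← hz ⟨EReal.coe_le_coe_iff.mp hab, le_rfl⟩]
    have hout := (continuous_output hg).comp hzc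
    exact le_apply_of_isGreatest (φ := fun t => ‖output g (z a) - output g (z t)‖ ^ 2)
      ((continuous_const.sub hout).norm.pow 2) (by fun_prop) hmax
  · exact absurd hbT (hb ▸ hT).not_gt

theorem isPerturbedFlow (hx : IsTrajectory G g α β T x τ) (l : Fin p) :
    IsPerturbedFlow G (g l) (errorEnvelope α β) (horizon T) (fun t i => x i t l)
      (fun t i => g l (sampled (x i) (τ i) t l) - g l (x i t l)) where
  continuousOn := continuousOn_pi.mpr fun i =>
    (EuclideanSpace.proj (𝕜 := ℝ) l).continuous.comp_continuousOn (hx.continuousOn i)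
  hasDerivWithinAt t ht := hasDerivWithinAt_pi.mpr fun i => by
    refine ((EuclideanSpace.proj (𝕜 := ℝ) l).hasFDerivAt.comp_hasDerivWithinAt t
      (hx.deriv_right i t ht.1 ht.2)).congr_deriv ?_
    simp [input, output, Matrix.mulVec, dotProduct]
  norm_error_le t ht := by
    have hnonneg : 0 ≤ errorEnvelope α β t := Finset.sum_nonneg fun _ _ => by positivity
    refine (pi_norm_le_iff_of_nonneg hnonneg).mpr fun i => le_errorEnvelope i ?_
    refine (pow_le_pow_left₀ (norm_nonneg _) ?_ 2).trans (hx.errorBound_sampled i ht)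
    exact PiLp.norm_apply_le (output g (sampled (x i) (τ i) t) - output g (x i t)) l

theorem uniformContinuousOn_output (hx : IsTrajectory G g α β T x τ)
    (hcont : ∀ l, Continuous (g l)) (hmono : ∀ l, Monotone (g l)) (hβ : ∀ i, 0 < β i)
    (i : Fin n) : UniformContinuousOn (fun t => output g (x i t)) (horizon T) := by
  have hcoord : ∀ l, UniformContinuousOn (fun t => g l (x i t l)) (horizon T) := fun l =>
    (Pi.uniformContinuous_proj _ i).comp_uniformContinuousOn
      ((hx.isPerturbedFlow l).uniformContinuousOn_comp (hmono l) (hasDerivAt_errorTail hβ)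
        (hcont l) (errorTail_nonneg hβ) (ordConnected_horizon T) (isLeast_horizon hx.horizon_pos)
        fun t ht => errorEnvelope_le hβ ht.1)
  refine (PiLp.uniformContinuous_toLp 2 _).comp_uniformContinuousOn ?_
  simp only [uniformContinuousOn_iff_restrict] at hcoord ⊢
  exact uniformContinuous_pi.mpr hcoord

theorem exists_le_sub (hx : IsTrajectory G g α β T x τ) (hcont : ∀ l, Continuous (g l))
    (hmono : ∀ l, Monotone (g l)) (hα : ∀ i, 0 < α i) (hβ : ∀ i, 0 < β i) (i : Fin n) (B : ℝ) :
    ∃ δ > 0, ∀ k (a b : ℝ), τ i k = a → τ i (k + 1) = b → (b : EReal) < T → b ≤ B →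
      δ ≤ b - a := by
  have hthreshold : 0 < α i * Real.exp (-β i * B) := mul_pos (hα i) (Real.exp_pos _)
  obtain ⟨δ, hδ, hclose⟩ := Metric.uniformContinuousOn_iff.mp
    (hx.uniformContinuousOn_output hcont hmono hβ i) _ (Real.sqrt_pos.mpr hthreshold)
  refine ⟨δ, hδ, fun k a b ha hb hbT hbB => ?_⟩
  obtain ⟨b', hb0, -, hb'⟩ := hx.exists_eq_coe hb.le
  obtain rfl : b = b' := EReal.coe_injective (hb.symm.trans hb')
  obtain ⟨a', ha0, hab, ha'⟩ :=
    hx.exists_eq_coe ((hx.monotone i (Nat.le_succ k)).trans hb.le)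
  obtain rfl : a = a' := EReal.coe_injective (ha.symm.trans ha')
  by_contra! hlt
  have hsmall := hclose a ⟨ha0, (EReal.coe_le_coe_iff.mpr hab).trans_lt hbT⟩ b ⟨hb0, hbT⟩
    (by rwa [dist_comm, Real.dist_eq, abs_of_nonneg (sub_nonneg.mpr hab)])
  rw [dist_eq_norm, Real.lt_sqrt (norm_nonneg _)] at hsmall
  refine ((hx.le_sq_norm_output_sub hcont ha hb hbT).trans_lt hsmall).not_ge ?_
  exact mul_le_mul_of_nonneg_left (Real.exp_le_exp.mpr
    (mul_le_mul_of_nonpos_left hbB (neg_nonpos.mpr (hβ i).le))) (hα i).le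

theorem noZeno_of_exists_le_sub (hx : IsTrajectory G g α β T x τ)
    (hgap : ∀ i (B : ℝ), ∃ δ > 0, ∀ k (a b : ℝ), τ i k = a → τ i (k + 1) = b →
      (b : EReal) < T → b ≤ B → δ ≤ b - a) : NoZeno T τ := by
  intro i B
  obtain ⟨δ, hδ, hsep⟩ := hgap i B
  have hlinear : ∀ (k : ℕ) (b : ℝ), τ i k = b → b ≤ B → (b : EReal) < T → k * δ ≤ b := fun k => by
    induction k with
    | zero =>
      intro b hb _ _
      simpa using EReal.coe_nonneg.mp (hx.first i ▸ hb).le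
    | succ k ih =>
      intro b hb hbB hbT
      obtain ⟨a, -, hab, ha⟩ :=
        hx.exists_eq_coe ((hx.monotone i (Nat.le_succ k)).trans hb.le)
      have hka := ih a ha (hab.trans hbB) ((EReal.coe_le_coe_iff.mpr hab).trans_lt hbT)
      have hδab := hsep k a b ha hb hbT hbB
      push_cast
      linarith
  refine (finite_Iic ⌊B / δ⌋₊).subset ?_
  rintro k ⟨hkB, hkT⟩
  obtain ⟨b, -, hbB, hb⟩ := hx.exists_eq_coe hkB
  exact Nat.le_floor ((le_div_iff₀ hδ).mpr ((hlinear k b hb hbB (hb ▸ hkT)).trans hbB))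

theorem tendsto_sum_smul {ξ : Fin n → ℝ} (hx : IsTrajectory G g α β ⊤ x τ)
    (hcont : ∀ l, Continuous (g l)) (hmono : ∀ l, Monotone (g l)) (hβ : ∀ i, 0 < β i)
    (hG : G.HasSpanningTree) (hξ : G.IsStationary ξ)
    (hν : ∀ l y, g l y = g l ((∑ i, ξ i • x i 0) l) → y = (∑ i, ξ i • x i 0) l) (i : Fin n) :
    Tendsto (x i) atTop (𝓝 (∑ i, ξ i • x i 0)) := by
  have hcoord : ∀ l, Tendsto (fun t => x i t l) atTop (𝓝 ((∑ i, ξ i • x i 0) l)) := fun l => by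
    have hsum : (∑ i, ξ i • x i 0) l = ξ ⬝ᵥ fun i => x i 0 l := by simp [dotProduct]
    have hflow := horizon_top ▸ hx.isPerturbedFlow l
    rw [hsum]
    exact hflow.tendsto_dotProduct (hmono l) (hcont l) (hasDerivAt_errorTail hβ)
      (errorTail_nonneg hβ) (tendsto_errorTail hβ) hG hξ (hsum ▸ hν l) i
  exact ((PiLp.continuous_toLp 2 _).tendsto _).comp (tendsto_pi_nhds.mpr hcoord)

end IsTrajectory

theorem OutputAssumption.eq_of_apply_eq {f : ℝ → ℝ} {h : ℝ} (hf : OutputAssumption f h) {θ y : ℝ}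
    (hθ : |θ| < h) (hy : f y = f θ) : y = θ := by
  obtain ⟨hlower, hupper⟩ := abs_lt.mp hθ
  have hmem : θ ∈ Icc (-h) h := ⟨hlower.le, hupper.le⟩
  have hle : y ≤ h := (hf.monotone.reflect_lt
    (hy.trans_lt (hf.strictMonoOn hmem ⟨by linarith, le_rfl⟩ hupper))).le
  have hge : -h ≤ y := (hf.monotone.reflect_lt
    ((hf.strictMonoOn ⟨le_rfl, by linarith⟩ hmem hlower).trans_eq hy.symm)).le
  exact hf.strictMonoOn.injOn ⟨hge, hle⟩ hmem hy

end EventTriggered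

open EventTriggered in
theorem theorem2_general {n p : ℕ} (G : WeightedDigraph n) (hG : G.HasSpanningTree)
    (ξ : Fin n → ℝ) (hξ : G.IsStationary ξ) (g : Fin p → ℝ → ℝ) (hcont : ∀ l, Continuous (g l))
    (hmono : ∀ l, Monotone (g l)) (α β : Fin n → ℝ) (hα : ∀ i, 0 < α i) (hβ : ∀ i, 0 < β i)
    (T : EReal) (x : Fin n → ℝ → EuclideanSpace ℝ (Fin p)) (τ : Fin n → ℕ → EReal)
    (hx : IsTrajectory G g α β T x τ) :
    NoZeno T τ ∧
    (T = ⊤ →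
      (∀ l y, g l y = g l ((∑ i, ξ i • x i 0) l) → y = (∑ i, ξ i • x i 0) l) →
      ∀ i, Tendsto (x i) atTop (𝓝 (∑ i, ξ i • x i 0))) := by
  refine ⟨hx.noZeno_of_exists_le_sub (hx.exists_le_sub hcont hmono hα hβ), ?_⟩
  rintro rfl hν
  exact hx.tendsto_sum_smul hcont hmono hβ hG hξ hν

theorem theorem2 {n p M : ℕ} (G : EventTriggered.WeightedDigraph n) (hG : G.HasSpanningTree)
    (c : Fin n → Fin (M + 1)) (hc : G.IsPerronFrobeniusForm c)
    (ξ : {i // c i = Fin.last M} → ℝ) (hξ : G.IsPerronVector c (Fin.last M) ξ)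
    (g : Fin p → ℝ → ℝ) (h : ℝ) (hg : ∀ l, EventTriggered.OutputAssumption (g l) h)
    (α β : Fin n → ℝ) (hα : ∀ i, 0 < α i) (hβ : ∀ i, 0 < β i)
    (T : EReal) (x : Fin n → ℝ → EuclideanSpace ℝ (Fin p)) (τ : Fin n → ℕ → EReal)
    (hx : EventTriggered.IsTrajectory G g α β T x τ)
    (hne : ∃ i, x i 0 ≠ EventTriggered.componentAverage c (Fin.last M) ξ x 0) :
    EventTriggered.NoZeno T τ ∧
    (T = ⊤ →
      (∀ l, |EventTriggered.componentAverage c (Fin.last M) ξ x 0 l| < h) →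
      ∀ i, Filter.Tendsto (x i) Filter.atTop
        (nhds (EventTriggered.componentAverage c (Fin.last M) ξ x 0))) := by
  have hgeneral := theorem2_general G hG _ (hξ.isStationary_extend hc) g
    (fun l => (hg l).continuous) (fun l => (hg l).monotone) α β hα hβ T x τ hx
  rw [EventTriggered.WeightedDigraph.sum_extend_val_smul ξ fun i => x i 0] at hgeneral
  exact hgeneral.imp_right fun hlim hT hν => hlim hT fun l _ => (hg l).eq_of_apply_eq (hν l)
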